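/- **Theorem (Cut elimination).** Let $\mathcal T$ be a theory in deduction modulo over a many-sorted (in particular, possibly single-sorted) first-order language, i.e. a set of axioms together with a congruence $\equiv$ on terms and propositions defined by a confluent rewrite system that rewrites terms to terms of the same sort and atomic propositions to propositions. Suppose that $\mathcal T$ is super-consistent: for every full, ordered and complete truth values algebra $\mathcal B$, there is a $\mathcal B$-valued structure with nonempty domains in which all axioms of $\mathcal T$ have a positive truth value under every assignment and in which congruent terms, and congruent propositions, have the same denotation under every assignment. Then every sequent $\Gamma \vdash B$ ($\Gamma$ a finite list of propositions, $B$ a proposition) that is provable in intuitionistic natural deduction modulo $\equiv$ has a cut-free proof in natural deduction modulo $\equiv$. Here: * A *truth values algebra* is a set $\mathcal B$ with a subset $\mathcal B^+$ of positive truth values, sets $\mathcal A,\mathcal E\subseteq\wp(\mathcal B)$, elements $\tilde\top,\tilde\bot$, binary operations $\tilde\Rightarrow,\tilde\wedge,\tilde\vee$ and maps $\tilde\forall:\mathcal A\to\mathcal B$, $\tilde\exists:\mathcal E\to\mathcal B$ such that for all $a,b,c\in\mathcal B$, $A\in\mathcal A$, $E\in\mathcal E$ ($\tilde\Rightarrow$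 associating to the right): if $a\,\tilde\Rightarrow\,b$ and $a$ are in $\mathcal B^+$ then so is $b$; the elements $a\tilde\Rightarrow b\tilde\Rightarrow a$, $(a\tilde\Rightarrow b\tilde\Rightarrow c)\tilde\Rightarrow(a\tilde\Rightarrow b)\tilde\Rightarrow a\tilde\Rightarrow c$, $\tilde\top$, $\tilde\bot\tilde\Rightarrow a$, $a\tilde\Rightarrow b\tilde\Rightarrow(a\tilde\wedge b)$, $(a\tilde\wedge b)\tilde\Rightarrow a$, $(a\tilde\wedge b)\tilde\Rightarrow b$, $a\tilde\Rightarrow(a\tilde\vee b)$, $b\tilde\Rightarrow(a\tilde\vee b)$, $(a\tilde\vee b)\tilde\Rightarrow(a\tilde\Rightarrow c)\tilde\Rightarrow(b\tilde\Rightarrow c)\tilde\Rightarrow c$ are in $\mathcal B^+$; the sets $a\tilde\Rightarrow A=\{a\tilde\Rightarrow e: e\in A\}$ and $E\tilde\Rightarrow a=\{e\tilde\Rightarrow a: e\in E\}$ are in $\mathcal A$; if $A\subseteq\mathcal B^+$ then $\tilde\forall A\in\mathcal B^+$; $\tilde\forall(a\tilde\Rightarrow A)\tilde\Rightarrow a\tilde\Rightarrow\tilde\forall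 A\in\mathcal B^+$; if $a\in A$ then $\tilde\forall A\tilde\Rightarrow a\in\mathcal B^+$; if $a\in E$ then $a\tilde\Rightarrow\tilde\exists E\in\mathcal B^+$; and $\tilde\exists E\tilde\Rightarrow\tilde\forall(E\tilde\Rightarrow a)\tilde\Rightarrow a\in\mathcal B^+$. It is *full* if $\mathcal A=\mathcal E=\wp(\mathcal B)$. It is *ordered* if it carries a partial order $\sqsubseteq$ for which $\mathcal B^+$ is upward closed, $\tilde\top$ is maximal and $\tilde\bot$ minimal, $\tilde\wedge$ and $\tilde\vee$ are monotone, $\tilde\Rightarrow$ is antitone on the left and monotone on the right, and $\tilde\forall,\tilde\exists$ are monotone: $\tilde\forall A\sqsubseteq\tilde\forall A'$ whenever every element of $A'$ is above some element of $A$, and $\tilde\exists E\sqsubseteq\tilde\exists E'$ whenever every element of $E$ is below some element of $E'$. It is *complete* if every subset has a greatest lower bound. * A $\mathcal B$-valued structure interprets each sort by a nonempty set, function symbols by functions, and predicate symbols by $\mathcal B$-valued functions; connectives are interpreted by the corresponding operations, $\llbracket\forall x\,A\rrbracket_\phi=\tilde\forall\{\llbracket A\rrbracket_{\phi+(d/x)}\}_d$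 and $\llbracket\exists x\,A\rrbracket_\phi=\tilde\exists\{\llbracket A\rrbracket_{\phi+(d/x)}\}_d$, where $d$ ranges over the domain of the sort of $x$. * *Natural deduction modulo* $\equiv$ has the usual axiom, introduction and elimination rules of intuitionistic natural deduction for $\top,\bot,\Rightarrow,\wedge,\vee,\forall,\exists$, where propositions may be replaced by congruent ones (for example, from $\Gamma\vdash C$ and $\Gamma\vdash A$ infer $\Gamma\vdash B$ if $C\equiv A\Rightarrow B$). * A proof is *neutral* if its last rule is the axiom rule or an elimination rule. *Cut-free* proofs are defined inductively: a proof ending with the axiom rule is cut-free; a proof ending with an introduction rule is cut-free if its premises are proved by cut-free proofs; a proof ending with an elimination rule is cut-free if its major premise is proved by a neutral cut-free proof and its other premises by cut-free proofs. -/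

import Mathlib

universe u v w

namespace DeductionModulo

/-! ## Many-sorted predicate logic

Bound variables are represented by de Bruijn indices, so that propositions are taken up to renaming
of bound variables.  Every sort has its own variables `0, 1, 2, …`; a quantifier over the sort `s`
binds the index `0` of sort `s` and leaves the variables of the other sorts alone. -/

/-- A many-sorted language: sorts, function symbols with their ranks and predicate symbols with
their ranks. -/
structure Language where
  Sorts : Type u
  Func : Type u
  arity : Func → ℕ
  dom : (f : Func) → Fin (arity f) → Sorts
  cod : Func → Sorts
  Pred : Type u
  predArity : Pred → ℕ
  predDom : (P : Pred) → Fin (predArity P) → Sorts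

/-- Terms of each sort. -/
inductive Term (L : Language.{u}) : L.Sorts → Type u
  | var (s : L.Sorts) (n : ℕ) : Term L s
  | app (f : L.Func) (ts : (i : Fin (L.arity f)) → Term L (L.dom f i)) : Term L (L.cod f)

/-- Propositions. -/
inductive Formula (L : Language.{u}) : Type u
  | atom (P : L.Pred) (ts : (i : Fin (L.predArity P)) → Term L (L.predDom P i)) : Formula L
  | top : Formula L
  | bot : Formula L
  | imp (A B : Formula L) : Formula L
  | and (A B : Formula L) : Formula L
  | or (A B : Formula L) : Formula L
  | all (s : L.Sorts) (A : Formula L) : Formula L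
  | ex (s : L.Sorts) (A : Formula L) : Formula L

/-- `extend d φ` maps the variable `0` of the sort of `d` to `d`, the variable `n + 1` of that sort
to the value of `n` under `φ`, and agrees with `φ` on the variables of the other sorts. -/
noncomputable def extend {ι : Type u} {D : ι → Type v} {s : ι} (d : D s)
    (φ : (s' : ι) → ℕ → D s') : (s' : ι) → ℕ → D s' :=
  open Classical in
  fun s' n =>
    if h : s = s' then
      match n with
      | 0 => h ▸ d
      | n + 1 => φ s' n
    else φ s' n

/-- Substitutions map the variables of each sort to terms of that sort. -/
abbrev Subst (L : Language.{u}) : Type u := (s : L.Sorts) → ℕ → Term L s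

/-- Simultaneous substitution in a term. -/
def Term.subst {L : Language.{u}} (σ : Subst L) : {s : L.Sorts} → Term L s → Term L s
  | _, .var s n => σ s n
  | _, .app f ts => .app f fun i => (ts i).subst σ

/-- The substitution that renames the variable `n` of sort `s` to `n + 1`. -/
noncomputable def shiftSubst {L : Language.{u}} (s : L.Sorts) : Subst L :=
  open Classical in
  fun s' n => .var s' (if s' = s then n + 1 else n)

/-- The substitution to be used below a quantifier over the sort `s`. -/
noncomputable def Subst.lift {L : Language.{u}} (s : L.Sorts) (σ : Subst L) : Subst L :=
  extend (Term.var s 0) fun s' n => (σ s' n).subst (shiftSubst s)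

/-- Simultaneous capture-avoiding substitution in a proposition. -/
noncomputable def Formula.subst {L : Language.{u}} : Subst L → Formula L → Formula L
  | σ, .atom P ts => .atom P fun i => (ts i).subst σ
  | _, .top => .top
  | _, .bot => .bot
  | σ, .imp A B => .imp (A.subst σ) (B.subst σ)
  | σ, .and A B => .and (A.subst σ) (B.subst σ)
  | σ, .or A B => .or (A.subst σ) (B.subst σ)
  | σ, .all s A => .all s (A.subst (σ.lift s))
  | σ, .ex s A => .ex s (A.subst (σ.lift s))

/-- Renames the free variables of a proposition so that the variable `0` of sort `s` is fresh. -/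
noncomputable def Formula.shift {L : Language.{u}} (s : L.Sorts) (A : Formula L) : Formula L :=
  A.subst (shiftSubst s)

/-- The instance `(t/x)A` of the body `A` of a quantified proposition; `x` is the variable `0` of
the sort of `t`. -/
noncomputable def Formula.inst {L : Language.{u}} {s : L.Sorts} (A : Formula L) (t : Term L s) :
    Formula L :=
  A.subst (extend t Term.var)

/-! ## Rewriting and theories in deduction modulo -/

/-- A rewrite system: rules rewriting terms to terms (of the same sort) and rules rewriting atomic
propositions to propositions. -/
structure RewriteSystem (L : Language.{u}) where
  termRule : {s : L.Sorts} → Term L s → Term L s → Prop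
  propRule : (P : L.Pred) → ((i : Fin (L.predArity P)) → Term L (L.predDom P i)) →
    Formula L → Prop

/-- One rewrite step in a term: an instance of a rule is applied to one subterm. -/
inductive TermStep {L : Language.{u}} (R : RewriteSystem L) :
    {s : L.Sorts} → Term L s → Term L s → Prop
  | rule {s : L.Sorts} {l r : Term L s} (h : R.termRule l r) (σ : Subst L) :
      TermStep R (l.subst σ) (r.subst σ)
  | app (f : L.Func) (ts : (i : Fin (L.arity f)) → Term L (L.dom f i)) (i : Fin (L.arity f))
      (t : Term L (L.dom f i)) (h : TermStep R (ts i) t) :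
      TermStep R (.app f ts) (.app f (Function.update ts i t))

/-- One rewrite step in a proposition: an instance of a rule is applied to one subterm or to one
atomic subproposition. -/
inductive FormulaStep {L : Language.{u}} (R : RewriteSystem L) : Formula L → Formula L → Prop
  | rule {P : L.Pred} {ts : (i : Fin (L.predArity P)) → Term L (L.predDom P i)} {A : Formula L}
      (h : R.propRule P ts A) (σ : Subst L) :
      FormulaStep R ((Formula.atom P ts).subst σ) (A.subst σ)
  | atom (P : L.Pred) (ts : (i : Fin (L.predArity P)) → Term L (L.predDom P i))
      (i : Fin (L.predArity P)) (t : Term L (L.predDom P i)) (h : TermStep R (ts i) t) :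
      FormulaStep R (.atom P ts) (.atom P (Function.update ts i t))
  | imp_left {A A' : Formula L} (B : Formula L) (h : FormulaStep R A A') :
      FormulaStep R (.imp A B) (.imp A' B)
  | imp_right (A : Formula L) {B B' : Formula L} (h : FormulaStep R B B') :
      FormulaStep R (.imp A B) (.imp A B')
  | and_left {A A' : Formula L} (B : Formula L) (h : FormulaStep R A A') :
      FormulaStep R (.and A B) (.and A' B)
  | and_right (A : Formula L) {B B' : Formula L} (h : FormulaStep R B B') :
      FormulaStep R (.and A B) (.and A B')
  | or_left {A A' : Formula L} (B : Formula L) (h : FormulaStep R A A') :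
      FormulaStep R (.or A B) (.or A' B)
  | or_right (A : Formula L) {B B' : Formula L} (h : FormulaStep R B B') :
      FormulaStep R (.or A B) (.or A B')
  | all (s : L.Sorts) {A A' : Formula L} (h : FormulaStep R A A') :
      FormulaStep R (.all s A) (.all s A')
  | ex (s : L.Sorts) {A A' : Formula L} (h : FormulaStep R A A') :
      FormulaStep R (.ex s A) (.ex s A')

/-- Confluence of a relation. -/
def Confluent {α : Type u} (r : α → α → Prop) : Prop :=
  ∀ a b c, Relation.ReflTransGen r a b → Relation.ReflTransGen r a c →
    ∃ d, Relation.ReflTransGen r b d ∧ Relation.ReflTransGen r c d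

/-- A rewrite system is confluent if rewriting is confluent on terms and on propositions. -/
def RewriteSystem.IsConfluent {L : Language.{u}} (R : RewriteSystem L) : Prop :=
  (∀ s : L.Sorts, Confluent (TermStep R (s := s))) ∧ Confluent (FormulaStep R)

/-- The congruence `≡` on terms defined by a rewrite system. -/
def TermCongr {L : Language.{u}} (R : RewriteSystem L) {s : L.Sorts} (t t' : Term L s) : Prop :=
  Relation.EqvGen (TermStep R) t t'

/-- The congruence `≡` on propositions defined by a rewrite system. -/
def Congr {L : Language.{u}} (R : RewriteSystem L) (A B : Formula L) : Prop :=
  Relation.EqvGen (FormulaStep R) A B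

/-- A theory in deduction modulo: a set of axioms together with a confluent rewrite system, which
defines the congruence of the theory. -/
structure Theory (L : Language.{u}) where
  axs : Set (Formula L)
  rules : RewriteSystem L
  confluent : rules.IsConfluent

/-! ## Natural deduction modulo -/

/-- Proofs (derivation trees) of sequents `Γ ⊢ A` in natural deduction modulo the congruence defined
by `R`.  The eigenvariable of `allI` and `exE` is the variable `0` of the sort `s`, which is made
fresh by shifting the variables of the other propositions. -/
inductive Proof {L : Language.{u}} (R : RewriteSystem L) : List (Formula L) → Formula L → Type u
  | hyp {Γ : List (Formula L)} (A B : Formula L) (hA : A ∈ Γ) (h : Congr R B A) : Proof R Γ B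
  | impI {Γ : List (Formula L)} {A B C : Formula L} (h : Congr R C (.imp A B))
      (p : Proof R (A :: Γ) B) : Proof R Γ C
  | impE {Γ : List (Formula L)} {A B C : Formula L} (h : Congr R C (.imp A B))
      (major : Proof R Γ C) (p : Proof R Γ A) : Proof R Γ B
  | andI {Γ : List (Formula L)} {A B C : Formula L} (h : Congr R C (.and A B))
      (p : Proof R Γ A) (q : Proof R Γ B) : Proof R Γ C
  | andE₁ {Γ : List (Formula L)} {A B C : Formula L} (h : Congr R C (.and A B))
      (major : Proof R Γ C) : Proof R Γ A
  | andE₂ {Γ : List (Formula L)} {A B C : Formula L} (h : Congr R C (.and A B))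
      (major : Proof R Γ C) : Proof R Γ B
  | orI₁ {Γ : List (Formula L)} {A B C : Formula L} (h : Congr R C (.or A B))
      (p : Proof R Γ A) : Proof R Γ C
  | orI₂ {Γ : List (Formula L)} {A B C : Formula L} (h : Congr R C (.or A B))
      (p : Proof R Γ B) : Proof R Γ C
  | orE {Γ : List (Formula L)} {A B C D : Formula L} (h : Congr R D (.or A B))
      (p : Proof R (A :: Γ) C) (q : Proof R (B :: Γ) C) (major : Proof R Γ D) : Proof R Γ C
  | topI {Γ : List (Formula L)} {A : Formula L} (h : Congr R A .top) : Proof R Γ A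
  | botE {Γ : List (Formula L)} {A B : Formula L} (h : Congr R B .bot)
      (major : Proof R Γ B) : Proof R Γ A
  | allI {Γ : List (Formula L)} {s : L.Sorts} {A B : Formula L} (h : Congr R B (.all s A))
      (p : Proof R (Γ.map (Formula.shift s)) A) : Proof R Γ B
  | allE {Γ : List (Formula L)} {s : L.Sorts} {A B C : Formula L} (t : Term L s)
      (h : Congr R B (.all s A)) (hC : Congr R C (A.inst t)) (major : Proof R Γ B) : Proof R Γ C
  | exI {Γ : List (Formula L)} {s : L.Sorts} {A B C : Formula L} (t : Term L s)
      (h : Congr R B (.ex s A)) (hC : Congr R C (A.inst t)) (p : Proof R Γ C) : Proof R Γ B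
  | exE {Γ : List (Formula L)} {s : L.Sorts} {A B C : Formula L} (h : Congr R C (.ex s A))
      (major : Proof R Γ C) (p : Proof R (A :: Γ.map (Formula.shift s)) (B.shift s)) : Proof R Γ B

/-- A proof is neutral if its last rule is the axiom rule or an elimination rule. -/
def Proof.IsNeutral {L : Language.{u}} {R : RewriteSystem L} {Γ : List (Formula L)}
    {A : Formula L} : Proof R Γ A → Prop
  | .hyp .. => True
  | .impE .. => True
  | .andE₁ .. => True
  | .andE₂ .. => True
  | .orE .. => True
  | .botE .. => True
  | .allE .. => True
  | .exE .. => True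
  | .impI .. => False
  | .andI .. => False
  | .orI₁ .. => False
  | .orI₂ .. => False
  | .topI .. => False
  | .allI .. => False
  | .exI .. => False

/-- A proof is cut-free if it ends with the axiom rule; or with an introduction rule whose premises
are proved by cut-free proofs; or with an elimination rule whose major premise is proved by a neutral
cut-free proof and whose other premises are proved by cut-free proofs. -/
def Proof.IsCutFree {L : Language.{u}} {R : RewriteSystem L} : {Γ : List (Formula L)} →
    {A : Formula L} → Proof R Γ A → Prop
  | _, _, .hyp .. => True
  | _, _, .impI _ p => p.IsCutFree
  | _, _, .impE _ m p => (m.IsNeutral ∧ m.IsCutFree) ∧ p.IsCutFree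
  | _, _, .andI _ p q => p.IsCutFree ∧ q.IsCutFree
  | _, _, .andE₁ _ m => m.IsNeutral ∧ m.IsCutFree
  | _, _, .andE₂ _ m => m.IsNeutral ∧ m.IsCutFree
  | _, _, .orI₁ _ p => p.IsCutFree
  | _, _, .orI₂ _ p => p.IsCutFree
  | _, _, .orE _ p q m => (m.IsNeutral ∧ m.IsCutFree) ∧ p.IsCutFree ∧ q.IsCutFree
  | _, _, .topI _ => True
  | _, _, .botE _ m => m.IsNeutral ∧ m.IsCutFree
  | _, _, .allI _ p => p.IsCutFree
  | _, _, .allE _ _ _ m => m.IsNeutral ∧ m.IsCutFree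
  | _, _, .exI _ _ _ p => p.IsCutFree
  | _, _, .exE _ m p => (m.IsNeutral ∧ m.IsCutFree) ∧ p.IsCutFree

/-! ## Truth values algebras -/

/-- Truth values algebras: the set `pos` of positive truth values is closed under the intuitionistic
deduction rules.  `allDom` and `exDom` are the domains of the infinitary operations. -/
structure TruthValuesAlgebra where
  carrier : Type w
  pos : Set carrier
  allDom : Set (Set carrier)
  exDom : Set (Set carrier)
  top : carrier
  bot : carrier
  imp : carrier → carrier → carrier
  and : carrier → carrier → carrier
  or : carrier → carrier → carrier
  all : allDom → carrier
  ex : exDom → carrier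
  mp : ∀ a b, imp a b ∈ pos → a ∈ pos → b ∈ pos
  imp_k : ∀ a b, imp a (imp b a) ∈ pos
  imp_s : ∀ a b c, imp (imp a (imp b c)) (imp (imp a b) (imp a c)) ∈ pos
  top_pos : top ∈ pos
  bot_imp : ∀ a, imp bot a ∈ pos
  and_intro : ∀ a b, imp a (imp b (and a b)) ∈ pos
  and_left : ∀ a b, imp (and a b) a ∈ pos
  and_right : ∀ a b, imp (and a b) b ∈ pos
  or_left : ∀ a b, imp a (or a b) ∈ pos
  or_right : ∀ a b, imp b (or a b) ∈ pos
  or_elim : ∀ a b c, imp (or a b) (imp (imp a c) (imp (imp b c) c)) ∈ pos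
  imp_allDom : ∀ (a : carrier) (A : Set carrier), A ∈ allDom → (fun e => imp a e) '' A ∈ allDom
  exDom_imp : ∀ (a : carrier) (E : Set carrier), E ∈ exDom → (fun e => imp e a) '' E ∈ allDom
  all_intro : ∀ A : allDom, (∀ a ∈ A.1, a ∈ pos) → all A ∈ pos
  all_imp : ∀ (a : carrier) (A : allDom),
    imp (all ⟨_, imp_allDom a A.1 A.2⟩) (imp a (all A)) ∈ pos
  all_elim : ∀ (A : allDom), ∀ a ∈ A.1, imp (all A) a ∈ pos
  ex_intro : ∀ (E : exDom), ∀ a ∈ E.1, imp a (ex E) ∈ pos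
  ex_elim : ∀ (a : carrier) (E : exDom),
    imp (ex E) (imp (all ⟨_, exDom_imp a E.1 E.2⟩) a) ∈ pos

/-- A truth values algebra is full if its infinitary operations are defined on all sets. -/
structure TruthValuesAlgebra.IsFull (𝓑 : TruthValuesAlgebra.{w}) : Prop where
  allDom_eq : 𝓑.allDom = Set.univ
  exDom_eq : 𝓑.exDom = Set.univ

/-- Ordered truth values algebras.  The infinitary operations are monotone in the following sense:
`∀̃ A ⊑ ∀̃ A'` if every element of `A'` is above some element of `A`, and `∃̃ E ⊑ ∃̃ E'` if every
element of `E` is below some element of `E'`. -/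
structure OrderedTruthValuesAlgebra extends TruthValuesAlgebra.{w} where
  le : carrier → carrier → Prop
  le_refl : ∀ a, le a a
  le_antisymm : ∀ a b, le a b → le b a → a = b
  le_trans : ∀ a b c, le a b → le b c → le a c
  pos_upward : ∀ a b, a ∈ pos → le a b → b ∈ pos
  top_maximal : ∀ a, le top a → a = top
  bot_minimal : ∀ a, le a bot → a = bot
  and_mono : ∀ a a' b b', le a a' → le b b' → le (and a b) (and a' b')
  or_mono : ∀ a a' b b', le a a' → le b b' → le (or a b) (or a' b')
  imp_mono : ∀ a a' b b', le a' a → le b b' → le (imp a b) (imp a' b')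
  all_mono : ∀ A A' : allDom, (∀ a' ∈ A'.1, ∃ a ∈ A.1, le a a') → le (all A) (all A')
  ex_mono : ∀ E E' : exDom, (∀ e ∈ E.1, ∃ e' ∈ E'.1, le e e') → le (ex E) (ex E')

/-- An ordered truth values algebra is complete if every set of truth values has a greatest lower
bound. -/
def OrderedTruthValuesAlgebra.IsComplete (𝓑 : OrderedTruthValuesAlgebra.{w}) : Prop :=
  ∀ A : Set 𝓑.carrier, ∃ g : 𝓑.carrier, (∀ a ∈ A, 𝓑.le g a) ∧
    ∀ b : 𝓑.carrier, (∀ a ∈ A, 𝓑.le b a) → 𝓑.le b g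

/-! ## Models and super-consistency -/

/-- `𝓑`-valued structures for a many-sorted language, with a nonempty domain for each sort. -/
structure BStructure (L : Language.{u}) (𝓑 : TruthValuesAlgebra.{w}) where
  Dom : L.Sorts → Type v
  nonempty : ∀ s, Nonempty (Dom s)
  func : (f : L.Func) → ((i : Fin (L.arity f)) → Dom (L.dom f i)) → Dom (L.cod f)
  pred : (P : L.Pred) → ((i : Fin (L.predArity P)) → Dom (L.predDom P i)) → 𝓑.carrier

/-- Assignments of elements of the domains to the variables. -/
abbrev BStructure.Assignment {L : Language.{u}} {𝓑 : TruthValuesAlgebra.{w}}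
    (M : BStructure.{u, v, w} L 𝓑) : Type (max u v) :=
  (s : L.Sorts) → ℕ → M.Dom s

/-- The denotation of a term. -/
def BStructure.denoteTerm {L : Language.{u}} {𝓑 : TruthValuesAlgebra.{w}}
    (M : BStructure.{u, v, w} L 𝓑) (φ : M.Assignment) : {s : L.Sorts} → Term L s → M.Dom s
  | _, .var s n => φ s n
  | _, .app f ts => M.func f fun i => M.denoteTerm φ (ts i)

/-- The denotation of a proposition in a structure over a full truth values algebra, where it is
always defined. -/
noncomputable def BStructure.denote {L : Language.{u}} {𝓑 : TruthValuesAlgebra.{w}}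
    (M : BStructure.{u, v, w} L 𝓑) (hB : 𝓑.IsFull) : M.Assignment → Formula L → 𝓑.carrier
  | φ, .atom P ts => M.pred P fun i => M.denoteTerm φ (ts i)
  | _, .top => 𝓑.top
  | _, .bot => 𝓑.bot
  | φ, .imp A B => 𝓑.imp (M.denote hB φ A) (M.denote hB φ B)
  | φ, .and A B => 𝓑.and (M.denote hB φ A) (M.denote hB φ B)
  | φ, .or A B => 𝓑.or (M.denote hB φ A) (M.denote hB φ B)
  | φ, .all s A => 𝓑.all ⟨Set.range fun d : M.Dom s => M.denote hB (extend d φ) A,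
      hB.allDom_eq ▸ Set.mem_univ _⟩
  | φ, .ex s A => 𝓑.ex ⟨Set.range fun d : M.Dom s => M.denote hB (extend d φ) A,
      hB.exDom_eq ▸ Set.mem_univ _⟩

/-- A structure over a full truth values algebra is a model of a theory if the axioms are valid (they
have a positive denotation under every assignment) and congruent terms and congruent propositions
have the same denotation under every assignment. -/
structure BStructure.IsModel {L : Language.{u}} {𝓑 : TruthValuesAlgebra.{w}}
    (M : BStructure.{u, v, w} L 𝓑) (hB : 𝓑.IsFull) (T : Theory L) : Prop where
  axs_valid : ∀ A ∈ T.axs, ∀ φ : M.Assignment, M.denote hB φ A ∈ 𝓑.pos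
  term_congr : ∀ (s : L.Sorts) (t t' : Term L s), TermCongr T.rules t t' →
    ∀ φ : M.Assignment, M.denoteTerm φ t = M.denoteTerm φ t'
  congr : ∀ A A' : Formula L, Congr T.rules A A' →
    ∀ φ : M.Assignment, M.denote hB φ A = M.denote hB φ A'

/-- A theory is super-consistent if it has a `𝓑`-valued model for every full, ordered and complete
truth values algebra `𝓑`. -/
def Theory.SuperConsistent {L : Language.{u}} (T : Theory L) : Prop :=
  ∀ (𝓑 : OrderedTruthValuesAlgebra.{u}) (hB : 𝓑.toTruthValuesAlgebra.IsFull), 𝓑.IsComplete →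
    ∃ M : BStructure.{u, v, u} L 𝓑.toTruthValuesAlgebra, M.IsModel hB T

end DeductionModulo

/-! The proof is a reducibility argument carried out in a truth values algebra. A truth value is a
set of sequents lying between those with a neutral cut-free proof and those with any cut-free proof,
closed under substitution, weakening and conversion. Implication and universal quantification are
read as in a Kripke model whose extensions are pairs of a substitution and a context. Ordered by
inclusion, these sets form a full, ordered and complete algebra (`sequentAlgebra`), so
super-consistency supplies a model in it where congruent propositions have equal denotations.
Recursion on propositions alone would not give this invariance, since a rewrite rule may turn an
atom into a compound proposition.

Adequacy (`Proof.mem_sequents`) is an induction on arbitrary proofs, cuts included: membership of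
the hypotheses in their denotations passes to the conclusion. At an elimination, either the major
premise has a neutral cut-free proof, and the rule applies to it without creating a cut, or the
clause defining the connective delivers the conclusion. For the identity substitution the hypotheses
are axioms, hence neutral, hence members of every value; so the conclusion is a member of its own
denotation and has a cut-free proof.

A value does not remember which proposition denotes it: a non-neutral member of an implication is
only known to be congruent to some implication. Confluence shows that its two sides are the expected
ones up to congruence (`Congr.imp_inj` and its analogues). The closure conditions on values rest on
`Proof.IsCutFree.transport`. -/

namespace DeductionModulo

variable {L : Language.{u}}

/-! ## Assignments and substitutions -/

section Extend

variable {ι : Type u} {D : ι → Type v}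

@[simp]
theorem extend_zero {s : ι} (d : D s) (φ : (s' : ι) → ℕ → D s') : extend d φ s 0 = d := by
  simp [extend]

@[simp]
theorem extend_succ {s : ι} (d : D s) (φ : (s' : ι) → ℕ → D s') (n : ℕ) :
    extend d φ s (n + 1) = φ s n := by
  simp [extend]

theorem extend_of_ne {s s' : ι} (h : s ≠ s') (d : D s) (φ : (s' : ι) → ℕ → D s') (n : ℕ) :
    extend d φ s' n = φ s' n := by
  simp [extend, h]

/-- Two assignments are equal if they agree on the variables of sort `s` and on the others. -/
theorem assignment_ext (s : ι) {φ ψ : (s' : ι) → ℕ → D s'} (h0 : φ s 0 = ψ s 0)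
    (hsucc : ∀ n, φ s (n + 1) = ψ s (n + 1)) (hne : ∀ s', s ≠ s' → ∀ n, φ s' n = ψ s' n) :
    φ = ψ := by
  funext s' n
  by_cases h : s = s'
  · subst h
    cases n with
    | zero => exact h0
    | succ n => exact hsucc n
  · exact hne s' h n

end Extend

@[simp]
theorem shiftSubst_self (s : L.Sorts) (n : ℕ) : shiftSubst (L := L) s s n = .var s (n + 1) := by
  simp [shiftSubst]

theorem shiftSubst_of_ne {s s' : L.Sorts} (h : s ≠ s') (n : ℕ) :
    shiftSubst (L := L) s s' n = .var s' n := by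
  simp [shiftSubst, h.symm]

/-- Composition of substitutions. -/
def Subst.comp (σ τ : Subst L) : Subst L := fun s n => (σ s n).subst τ

theorem Term.subst_subst (σ τ : Subst L) {s : L.Sorts} (t : Term L s) :
    (t.subst σ).subst τ = t.subst (σ.comp τ) := by
  induction t with
  | var s n => rfl
  | app f ts ih => simp only [Term.subst, ih]

@[simp]
theorem Term.subst_var {s : L.Sorts} (t : Term L s) : t.subst Term.var = t := by
  induction t with
  | var s n => rfl
  | app f ts ih => simp only [Term.subst, ih]

theorem Subst.shift_comp_lift (s : L.Sorts) (σ : Subst L) :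
    (shiftSubst s).comp (σ.lift s) = σ.comp (shiftSubst s) := by
  apply assignment_ext s
  · simp [Subst.comp, Term.subst, Subst.lift]
  · intro n
    simp [Subst.comp, Term.subst, Subst.lift]
  · intro s' h n
    simp [Subst.comp, Term.subst, Subst.lift, shiftSubst_of_ne h, extend_of_ne h]

theorem Subst.lift_comp_lift (s : L.Sorts) (σ τ : Subst L) :
    (σ.lift s).comp (τ.lift s) = (σ.comp τ).lift s := by
  apply assignment_ext s
  · simp [Subst.comp, Subst.lift, Term.subst]
  · intro n
    have := Subst.shift_comp_lift s τ
    simp only [Subst.comp, Subst.lift, extend_succ, Term.subst_subst] at this ⊢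
    rw [this]
  · intro s' h n
    have := Subst.shift_comp_lift s τ
    simp only [Subst.comp, Subst.lift, extend_of_ne h, Term.subst_subst] at this ⊢
    rw [this]

@[simp]
theorem Subst.lift_var (s : L.Sorts) : Subst.lift s (Term.var : Subst L) = Term.var := by
  apply assignment_ext s
  · simp [Subst.lift]
  · intro n
    simp [Subst.lift, Term.subst]
  · intro s' h n
    simp [Subst.lift, Term.subst, extend_of_ne h, shiftSubst_of_ne h]

theorem Subst.shift_comp_extend {s : L.Sorts} (t : Term L s) (σ : Subst L) :
    (shiftSubst s).comp (extend t σ) = σ := by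
  apply assignment_ext s
  · simp [Subst.comp, Term.subst]
  · intro n
    simp [Subst.comp, Term.subst]
  · intro s' h n
    simp [Subst.comp, Term.subst, shiftSubst_of_ne h, extend_of_ne h]

/-- This merges a substitution under a binder with the later instantiation of the bound variable,
the form in which the quantifier clauses of the algebra are checked. -/
theorem Subst.lift_comp_extend {s : L.Sorts} (t : Term L s) (σ τ : Subst L) :
    (σ.lift s).comp (extend t τ) = extend t (σ.comp τ) := by
  apply assignment_ext s
  · simp [Subst.comp, Term.subst, Subst.lift]
  · intro n
    have := Subst.shift_comp_extend t τ
    simp only [Subst.comp, Subst.lift, extend_succ, Term.subst_subst] at this ⊢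
    rw [this]
  · intro s' h n
    have := Subst.shift_comp_extend t τ
    simp only [Subst.comp, Subst.lift, extend_of_ne h, Term.subst_subst] at this ⊢
    rw [this]

theorem Subst.extend_comp {s : L.Sorts} (t : Term L s) (σ τ : Subst L) :
    Subst.comp (extend t σ) τ = extend (t.subst τ) (σ.comp τ) := by
  apply assignment_ext s
  · simp [Subst.comp]
  · intro n
    simp [Subst.comp]
  · intro s' h n
    simp [Subst.comp, extend_of_ne h]

@[simp]
theorem Subst.comp_var (σ : Subst L) : σ.comp Term.var = σ := by
  funext s n
  simp [Subst.comp]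

@[simp]
theorem Subst.var_comp (σ : Subst L) : Subst.comp Term.var σ = σ := rfl

theorem Formula.subst_subst (A : Formula L) (σ τ : Subst L) :
    (A.subst σ).subst τ = A.subst (σ.comp τ) := by
  induction A generalizing σ τ <;>
    simp_all [Formula.subst, Term.subst_subst, Subst.lift_comp_lift]

@[simp]
theorem Formula.subst_var (A : Formula L) : A.subst Term.var = A := by
  induction A <;> simp_all [Formula.subst]

theorem Formula.subst_shift (s : L.Sorts) (A : Formula L) (σ : Subst L) :
    (A.shift s).subst (σ.lift s) = (A.subst σ).shift s := by
  simp only [Formula.shift, Formula.subst_subst, Subst.shift_comp_lift]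

theorem Formula.shift_subst_extend {s : L.Sorts} (A : Formula L) (t : Term L s) (σ : Subst L) :
    (A.shift s).subst (extend t σ) = A.subst σ := by
  simp only [Formula.shift, Formula.subst_subst, Subst.shift_comp_extend]

theorem Formula.subst_lift_extend {s : L.Sorts} (A : Formula L) (t : Term L s) (σ τ : Subst L) :
    (A.subst (σ.lift s)).subst (extend t τ) = A.subst (extend t (σ.comp τ)) := by
  rw [Formula.subst_subst, Subst.lift_comp_extend]

theorem Formula.subst_lift_inst {s : L.Sorts} (A : Formula L) (t : Term L s) (σ : Subst L) :
    (A.subst (σ.lift s)).inst t = A.subst (extend t σ) := by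
  rw [Formula.inst, Formula.subst_lift_extend, Subst.comp_var]

theorem Formula.inst_subst {s : L.Sorts} (A : Formula L) (t : Term L s) (σ : Subst L) :
    (A.inst t).subst σ = A.subst (extend (t.subst σ) σ) := by
  rw [Formula.inst, Formula.subst_subst, Subst.extend_comp, Subst.var_comp]

/-! ## The congruence -/

section Congruence

variable {R : RewriteSystem L}

/-- An instance of a rule by `σ`, further substituted by `ρ`, is the instance by the composite. -/
theorem TermStep.subst {s : L.Sorts} {t t' : Term L s} (h : TermStep R t t') (ρ : Subst L) :
    TermStep R (t.subst ρ) (t'.subst ρ) := by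
  induction h with
  | rule h σ =>
    rw [Term.subst_subst, Term.subst_subst]
    exact .rule h _
  | app f ts i t h ih =>
    have e : (fun j => (Function.update ts i t j).subst ρ) =
        Function.update (fun j => (ts j).subst ρ) i (t.subst ρ) := by
      funext j
      exact Function.apply_update (fun _ (x : Term L _) => x.subst ρ) ts i t j
    simp only [Term.subst]
    rw [e]
    exact .app f _ i _ ih

theorem FormulaStep.subst {A B : Formula L} (h : FormulaStep R A B) (ρ : Subst L) :
    FormulaStep R (A.subst ρ) (B.subst ρ) := by
  induction h generalizing ρ with
  | rule h σ =>
    rw [Formula.subst_subst, Formula.subst_subst]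
    exact .rule h _
  | atom P ts i t h =>
    have e : (fun j => (Function.update ts i t j).subst ρ) =
        Function.update (fun j => (ts j).subst ρ) i (t.subst ρ) := by
      funext j
      exact Function.apply_update (fun _ (x : Term L _) => x.subst ρ) ts i t j
    simp only [Formula.subst]
    rw [e]
    exact .atom P _ i _ (h.subst ρ)
  | imp_left B h ih => exact .imp_left _ (ih ρ)
  | imp_right B h ih => exact .imp_right _ (ih ρ)
  | and_left B h ih => exact .and_left _ (ih ρ)
  | and_right B h ih => exact .and_right _ (ih ρ)
  | or_left B h ih => exact .or_left _ (ih ρ)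
  | or_right B h ih => exact .or_right _ (ih ρ)
  | all s h ih => exact .all _ (ih _)
  | ex s h ih => exact .ex _ (ih _)

/-- A function that maps rewrite steps to rewrite steps preserves the congruence. -/
theorem Congr.map {f : Formula L → Formula L}
    (hf : ∀ A B, FormulaStep R A B → FormulaStep R (f A) (f B)) {A B : Formula L}
    (h : Congr R A B) : Congr R (f A) (f B) := by
  induction h with
  | rel A B h => exact .rel _ _ (hf A B h)
  | refl A => exact .refl _
  | symm A B _ ih => exact .symm _ _ ih
  | trans A B C _ _ ih ih' => exact .trans _ _ _ ih ih'

theorem Congr.refl (A : Formula L) : Congr R A A := Relation.EqvGen.refl A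

theorem Congr.symm {A B : Formula L} (h : Congr R A B) : Congr R B A :=
  Relation.EqvGen.symm _ _ h

theorem Congr.trans {A B C : Formula L} (h : Congr R A B) (h' : Congr R B C) : Congr R A C :=
  Relation.EqvGen.trans _ _ _ h h'

theorem Congr.subst {A B : Formula L} (h : Congr R A B) (ρ : Subst L) :
    Congr R (A.subst ρ) (B.subst ρ) :=
  h.map (f := fun A => A.subst ρ) fun _ _ h => h.subst ρ

theorem Congr.shift {A B : Formula L} (h : Congr R A B) (s : L.Sorts) :
    Congr R (A.shift s) (B.shift s) :=
  h.subst _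

theorem Congr.inst {A B : Formula L} (h : Congr R A B) {s : L.Sorts} (t : Term L s) :
    Congr R (A.inst t) (B.inst t) :=
  h.subst _

/-- This and the two conjunction lemmas serve `Proof.IsCutFree.transport`: the conclusion of these
eliminations is a part of the major formula, so converting it means converting inside the
connective. -/
theorem Congr.imp_right {A B B' : Formula L} (h : Congr R B B') :
    Congr R (.imp A B) (.imp A B') :=
  h.map (f := fun B => .imp A B) fun _ _ h => .imp_right _ h

theorem Congr.and_left {A A' B : Formula L} (h : Congr R A A') :
    Congr R (.and A B) (.and A' B) :=
  h.map (f := fun A => .and A B) fun _ _ h => .and_left _ h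

theorem Congr.and_right {A B B' : Formula L} (h : Congr R B B') :
    Congr R (.and A B) (.and A B') :=
  h.map (f := fun B => .and A B) fun _ _ h => .and_right _ h

/-! ### Confluence and the injectivity of connectives up to congruence. -/

theorem Congr.of_reflTransGen {A B : Formula L} (h : Relation.ReflTransGen (FormulaStep R) A B) :
    Congr R A B := by
  induction h with
  | refl => exact .refl _
  | tail _ h ih => exact ih.trans (.rel _ _ h)

/-- The Church-Rosser property. -/
theorem Congr.exists_common_reduct (hR : R.IsConfluent) {A B : Formula L} (h : Congr R A B) :
    ∃ C, Relation.ReflTransGen (FormulaStep R) A C ∧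
      Relation.ReflTransGen (FormulaStep R) B C := by
  induction h with
  | rel A B h => exact ⟨B, .single h, .refl⟩
  | refl A => exact ⟨A, .refl, .refl⟩
  | symm A B _ ih =>
    obtain ⟨C, h₁, h₂⟩ := ih
    exact ⟨C, h₂, h₁⟩
  | trans A B C _ _ ih ih' =>
    obtain ⟨D, h₁, h₂⟩ := ih
    obtain ⟨D', h₁', h₂'⟩ := ih'
    -- `D` and `D'` are both reducts of the middle proposition `B`, so confluence joins them.
    obtain ⟨E, h, h'⟩ := hR.2 _ _ _ h₂ h₁'
    exact ⟨E, h₁.trans h, h₂'.trans h'⟩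

/-- Reduction keeps the outermost connective or quantifier, and reduces below it. -/
def Formula.SameShape (R : RewriteSystem L) : Formula L → Formula L → Prop
  | .imp A B, C => ∃ A' B', C = .imp A' B' ∧ Congr R A A' ∧ Congr R B B'
  | .and A B, C => ∃ A' B', C = .and A' B' ∧ Congr R A A' ∧ Congr R B B'
  | .or A B, C => ∃ A' B', C = .or A' B' ∧ Congr R A A' ∧ Congr R B B'
  | .all s A, C => ∃ A', C = .all s A' ∧ Congr R A A'
  | .ex s A, C => ∃ A', C = .ex s A' ∧ Congr R A A'
  -- An atom may be rewritten to any shape, and `⊤` and `⊥` have no parts to compare.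
  | _, _ => True

theorem FormulaStep.sameShape {A B : Formula L} (h : FormulaStep R A B) :
    A.SameShape R B := by
  cases h with
  -- The left-hand side of a rule is atomic, so a rule never acts at an outermost connective.
  | rule h σ => trivial
  | atom => trivial
  | imp_left B h => exact ⟨_, _, rfl, .rel _ _ h, .refl _⟩
  | imp_right B h => exact ⟨_, _, rfl, .refl _, .rel _ _ h⟩
  | and_left B h => exact ⟨_, _, rfl, .rel _ _ h, .refl _⟩
  | and_right B h => exact ⟨_, _, rfl, .refl _, .rel _ _ h⟩
  | or_left B h => exact ⟨_, _, rfl, .rel _ _ h, .refl _⟩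
  | or_right B h => exact ⟨_, _, rfl, .refl _, .rel _ _ h⟩
  | all s h => exact ⟨_, rfl, .rel _ _ h⟩
  | ex s h => exact ⟨_, rfl, .rel _ _ h⟩

theorem Formula.SameShape.trans {A B C : Formula L} (h : A.SameShape R B)
    (h' : B.SameShape R C) : A.SameShape R C := by
  cases A with
  | atom | top | bot => trivial
  | imp | and | or =>
    obtain ⟨A', B', rfl, h₁, h₂⟩ := h
    obtain ⟨A'', B'', rfl, h₁', h₂'⟩ := h'
    exact ⟨_, _, rfl, h₁.trans h₁', h₂.trans h₂'⟩
  | all | ex =>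
    obtain ⟨A', rfl, h₁⟩ := h
    obtain ⟨A'', rfl, h₁'⟩ := h'
    exact ⟨_, rfl, h₁.trans h₁'⟩

theorem Formula.SameShape.refl (A : Formula L) : A.SameShape R A := by
  cases A with
  | atom | top | bot => trivial
  | imp | and | or => exact ⟨_, _, rfl, .refl _, .refl _⟩
  | all | ex => exact ⟨_, rfl, .refl _⟩

theorem Formula.SameShape.of_reflTransGen {A B : Formula L}
    (h : Relation.ReflTransGen (FormulaStep R) A B) : A.SameShape R B := by
  induction h with
  | refl => exact .refl _
  | tail _ h ih => exact ih.trans h.sameShape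

/-- Congruent propositions reduce to a proposition that has the shape of both of them. -/
theorem Congr.exists_sameShape (hR : R.IsConfluent) {A B : Formula L} (h : Congr R A B) :
    ∃ C, A.SameShape R C ∧ B.SameShape R C := by
  obtain ⟨C, h₁, h₂⟩ := h.exists_common_reduct hR
  exact ⟨C, .of_reflTransGen h₁, .of_reflTransGen h₂⟩

/-- The common reduct has the shape of both implications, so its two sides link theirs. Without
confluence a congruence could pass through an atom that rewrites to two unrelated implications. -/
theorem Congr.imp_inj (hR : R.IsConfluent) {A B A' B' : Formula L}
    (h : Congr R (.imp A B) (.imp A' B')) : Congr R A A' ∧ Congr R B B' := by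
  obtain ⟨C, ⟨_, _, rfl, h₁, h₂⟩, ⟨_, _, e, h₁', h₂'⟩⟩ := h.exists_sameShape hR
  cases e
  exact ⟨h₁.trans h₁'.symm, h₂.trans h₂'.symm⟩

theorem Congr.and_inj (hR : R.IsConfluent) {A B A' B' : Formula L}
    (h : Congr R (.and A B) (.and A' B')) : Congr R A A' ∧ Congr R B B' := by
  obtain ⟨C, ⟨_, _, rfl, h₁, h₂⟩, ⟨_, _, e, h₁', h₂'⟩⟩ := h.exists_sameShape hR
  cases e
  exact ⟨h₁.trans h₁'.symm, h₂.trans h₂'.symm⟩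

theorem Congr.or_inj (hR : R.IsConfluent) {A B A' B' : Formula L}
    (h : Congr R (.or A B) (.or A' B')) : Congr R A A' ∧ Congr R B B' := by
  obtain ⟨C, ⟨_, _, rfl, h₁, h₂⟩, ⟨_, _, e, h₁', h₂'⟩⟩ := h.exists_sameShape hR
  cases e
  exact ⟨h₁.trans h₁'.symm, h₂.trans h₂'.symm⟩

theorem Congr.all_inj (hR : R.IsConfluent) {s s' : L.Sorts} {A A' : Formula L}
    (h : Congr R (.all s A) (.all s' A')) : s = s' ∧ Congr R A A' := by
  obtain ⟨C, ⟨_, rfl, h₁⟩, ⟨_, e, h₁'⟩⟩ := h.exists_sameShape hR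
  cases e
  exact ⟨rfl, h₁.trans h₁'.symm⟩

theorem Congr.ex_inj (hR : R.IsConfluent) {s s' : L.Sorts} {A A' : Formula L}
    (h : Congr R (.ex s A) (.ex s' A')) : s = s' ∧ Congr R A A' := by
  obtain ⟨C, ⟨_, rfl, h₁⟩, ⟨_, e, h₁'⟩⟩ := h.exists_sameShape hR
  cases e
  exact ⟨rfl, h₁.trans h₁'.symm⟩

end Congruence

/-! ## Denotations and substitutions -/

section Denotation

variable {𝓑 : TruthValuesAlgebra.{w}} (M : BStructure.{u, v, w} L 𝓑)

theorem BStructure.denoteTerm_subst (φ : M.Assignment) (σ : Subst L) {s : L.Sorts}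
    (t : Term L s) :
    M.denoteTerm φ (t.subst σ) = M.denoteTerm (fun s n => M.denoteTerm φ (σ s n)) t := by
  induction t with
  | var s n => rfl
  | app f ts ih => simp only [Term.subst, BStructure.denoteTerm, ih]

theorem BStructure.denoteTerm_shift (φ : M.Assignment) {s : L.Sorts} (d : M.Dom s) :
    (fun s' n => M.denoteTerm (extend d φ) (shiftSubst s s' n)) = φ := by
  apply assignment_ext s
  · simp [BStructure.denoteTerm]
  · intro n
    simp [BStructure.denoteTerm]
  · intro s' h n
    simp [BStructure.denoteTerm, shiftSubst_of_ne h, extend_of_ne h]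

theorem BStructure.denoteTerm_lift (φ : M.Assignment) (σ : Subst L) {s : L.Sorts} (d : M.Dom s) :
    (fun s' n => M.denoteTerm (extend d φ) (σ.lift s s' n)) =
      extend d fun s' n => M.denoteTerm φ (σ s' n) := by
  apply assignment_ext s
  · simp [Subst.lift, BStructure.denoteTerm]
  · intro n
    simp [Subst.lift, BStructure.denoteTerm_subst, BStructure.denoteTerm_shift]
  · intro s' h n
    simp [Subst.lift, BStructure.denoteTerm_subst, BStructure.denoteTerm_shift, extend_of_ne h]

theorem BStructure.denoteTerm_extend (φ : M.Assignment) {s : L.Sorts} (t : Term L s) :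
    (fun s' n => M.denoteTerm φ ((extend t Term.var : Subst L) s' n)) =
      extend (M.denoteTerm φ t) φ := by
  apply assignment_ext s
  · simp
  · intro n
    simp [BStructure.denoteTerm]
  · intro s' h n
    simp [BStructure.denoteTerm, extend_of_ne h]

variable (hB : 𝓑.IsFull)

theorem BStructure.denote_subst (A : Formula L) (φ : M.Assignment) (σ : Subst L) :
    M.denote hB φ (A.subst σ) = M.denote hB (fun s n => M.denoteTerm φ (σ s n)) A := by
  induction A generalizing φ σ with
  | atom P ts => simp only [Formula.subst, BStructure.denote, BStructure.denoteTerm_subst]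
  | top | bot => rfl
  | imp A B ihA ihB | and A B ihA ihB | or A B ihA ihB =>
    simp only [Formula.subst, BStructure.denote, ihA, ihB]
  | all s A ih | ex s A ih =>
    simp only [Formula.subst, BStructure.denote, ih, BStructure.denoteTerm_lift]

/-- The semantic side of the eigenvariable condition: the value given to a fresh variable is
irrelevant. -/
theorem BStructure.denote_shift (A : Formula L) (φ : M.Assignment) {s : L.Sorts} (d : M.Dom s) :
    M.denote hB (extend d φ) (A.shift s) = M.denote hB φ A := by
  rw [Formula.shift, BStructure.denote_subst, BStructure.denoteTerm_shift]

theorem BStructure.denote_inst (A : Formula L) (φ : M.Assignment) {s : L.Sorts} (t : Term L s) :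
    M.denote hB φ (A.inst t) = M.denote hB (extend (M.denoteTerm φ t) φ) A := by
  rw [Formula.inst, BStructure.denote_subst, BStructure.denoteTerm_extend]

end Denotation

/-! ## Cut-free provability -/

section CutFree

variable {R : RewriteSystem L}

/-- Sequents that have a cut-free proof. -/
def CutFreeProvable (R : RewriteSystem L) (Γ : List (Formula L)) (A : Formula L) : Prop :=
  ∃ p : Proof R Γ A, p.IsCutFree

/-- Sequents that have a neutral cut-free proof. -/
def NeutralProvable (R : RewriteSystem L) (Γ : List (Formula L)) (A : Formula L) : Prop :=
  ∃ p : Proof R Γ A, p.IsNeutral ∧ p.IsCutFree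

/-! ### The deduction rules as closure properties of neutral and cut-free provability. -/

theorem NeutralProvable.cutFree {Γ : List (Formula L)} {A : Formula L}
    (h : NeutralProvable R Γ A) : CutFreeProvable R Γ A :=
  ⟨h.choose, h.choose_spec.2⟩

theorem NeutralProvable.hyp {Γ : List (Formula L)} {A B : Formula L} (hA : A ∈ Γ)
    (h : Congr R B A) : NeutralProvable R Γ B :=
  ⟨.hyp A B hA h, trivial, trivial⟩

theorem NeutralProvable.impE {Γ : List (Formula L)} {A B C : Formula L}
    (h : Congr R C (.imp A B)) (hC : NeutralProvable R Γ C) (hA : CutFreeProvable R Γ A) :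
    NeutralProvable R Γ B := by
  obtain ⟨m, hm⟩ := hC
  obtain ⟨p, hp⟩ := hA
  exact ⟨.impE h m p, trivial, hm, hp⟩

theorem NeutralProvable.andE₁ {Γ : List (Formula L)} {A B C : Formula L}
    (h : Congr R C (.and A B)) (hC : NeutralProvable R Γ C) : NeutralProvable R Γ A := by
  obtain ⟨m, hm⟩ := hC
  exact ⟨.andE₁ h m, trivial, hm⟩

theorem NeutralProvable.andE₂ {Γ : List (Formula L)} {A B C : Formula L}
    (h : Congr R C (.and A B)) (hC : NeutralProvable R Γ C) : NeutralProvable R Γ B := by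
  obtain ⟨m, hm⟩ := hC
  exact ⟨.andE₂ h m, trivial, hm⟩

theorem NeutralProvable.orE {Γ : List (Formula L)} {A B C D : Formula L}
    (h : Congr R D (.or A B)) (hA : CutFreeProvable R (A :: Γ) C)
    (hB : CutFreeProvable R (B :: Γ) C) (hD : NeutralProvable R Γ D) :
    NeutralProvable R Γ C := by
  obtain ⟨p, hp⟩ := hA
  obtain ⟨q, hq⟩ := hB
  obtain ⟨m, hm⟩ := hD
  exact ⟨.orE h p q m, trivial, hm, hp, hq⟩

theorem NeutralProvable.botE {Γ : List (Formula L)} {A B : Formula L} (h : Congr R B .bot)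
    (hB : NeutralProvable R Γ B) : NeutralProvable R Γ A := by
  obtain ⟨m, hm⟩ := hB
  exact ⟨.botE h m, trivial, hm⟩

theorem NeutralProvable.allE {Γ : List (Formula L)} {s : L.Sorts} {A B C : Formula L}
    (t : Term L s) (h : Congr R B (.all s A)) (hC : Congr R C (A.inst t))
    (hB : NeutralProvable R Γ B) : NeutralProvable R Γ C := by
  obtain ⟨m, hm⟩ := hB
  exact ⟨.allE t h hC m, trivial, hm⟩

theorem NeutralProvable.exE {Γ : List (Formula L)} {s : L.Sorts} {A B C : Formula L}
    (h : Congr R C (.ex s A)) (hC : NeutralProvable R Γ C)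
    (hB : CutFreeProvable R (A :: Γ.map (Formula.shift s)) (B.shift s)) :
    NeutralProvable R Γ B := by
  obtain ⟨m, hm⟩ := hC
  obtain ⟨p, hp⟩ := hB
  exact ⟨.exE h m p, trivial, hm, hp⟩

theorem CutFreeProvable.impI {Γ : List (Formula L)} {A B C : Formula L}
    (h : Congr R C (.imp A B)) (hB : CutFreeProvable R (A :: Γ) B) : CutFreeProvable R Γ C := by
  obtain ⟨p, hp⟩ := hB
  exact ⟨.impI h p, hp⟩

theorem CutFreeProvable.andI {Γ : List (Formula L)} {A B C : Formula L}
    (h : Congr R C (.and A B)) (hA : CutFreeProvable R Γ A) (hB : CutFreeProvable R Γ B) :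
    CutFreeProvable R Γ C := by
  obtain ⟨p, hp⟩ := hA
  obtain ⟨q, hq⟩ := hB
  exact ⟨.andI h p q, hp, hq⟩

theorem CutFreeProvable.orI₁ {Γ : List (Formula L)} {A B C : Formula L}
    (h : Congr R C (.or A B)) (hA : CutFreeProvable R Γ A) : CutFreeProvable R Γ C := by
  obtain ⟨p, hp⟩ := hA
  exact ⟨.orI₁ h p, hp⟩

theorem CutFreeProvable.orI₂ {Γ : List (Formula L)} {A B C : Formula L}
    (h : Congr R C (.or A B)) (hB : CutFreeProvable R Γ B) : CutFreeProvable R Γ C := by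
  obtain ⟨p, hp⟩ := hB
  exact ⟨.orI₂ h p, hp⟩

theorem CutFreeProvable.topI {Γ : List (Formula L)} {A : Formula L} (h : Congr R A .top) :
    CutFreeProvable R Γ A :=
  ⟨.topI h, trivial⟩

theorem CutFreeProvable.allI {Γ : List (Formula L)} {s : L.Sorts} {A B : Formula L}
    (h : Congr R B (.all s A)) (hA : CutFreeProvable R (Γ.map (Formula.shift s)) A) :
    CutFreeProvable R Γ B := by
  obtain ⟨p, hp⟩ := hA
  exact ⟨.allI h p, hp⟩

theorem CutFreeProvable.exI {Γ : List (Formula L)} {s : L.Sorts} {A B C : Formula L}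
    (t : Term L s) (h : Congr R B (.ex s A)) (hC : Congr R C (A.inst t))
    (hp : CutFreeProvable R Γ C) : CutFreeProvable R Γ B := by
  obtain ⟨p, hp⟩ := hp
  exact ⟨.exI t h hC p, hp⟩

/-- `Δ` contains the instances by `ρ` of the propositions of `Γ`. -/
def ContextMap (ρ : Subst L) (Γ Δ : List (Formula L)) : Prop :=
  ∀ A ∈ Γ, A.subst ρ ∈ Δ

theorem ContextMap.cons {ρ : Subst L} {Γ Δ : List (Formula L)} (h : ContextMap ρ Γ Δ)
    (A : Formula L) : ContextMap ρ (A :: Γ) (A.subst ρ :: Δ) := by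
  intro X hX
  rcases List.mem_cons.1 hX with rfl | hX
  · exact List.mem_cons_self
  · exact List.mem_cons_of_mem _ (h X hX)

theorem ContextMap.lift {ρ : Subst L} {Γ Δ : List (Formula L)} (h : ContextMap ρ Γ Δ)
    (s : L.Sorts) :
    ContextMap (ρ.lift s) (Γ.map (Formula.shift s)) (Δ.map (Formula.shift s)) := by
  intro X hX
  obtain ⟨A, hA, rfl⟩ := List.mem_map.1 hX
  rw [Formula.subst_shift]
  exact List.mem_map.2 ⟨_, h A hA, rfl⟩

theorem ContextMap.comp {ρ τ : Subst L} {Γ Δ Θ : List (Formula L)} (h : ContextMap ρ Γ Δ)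
    (h' : ContextMap τ Δ Θ) : ContextMap (ρ.comp τ) Γ Θ := by
  intro A hA
  rw [← Formula.subst_subst]
  exact h' _ (h A hA)

theorem ContextMap.of_subset {Γ Δ : List (Formula L)} (h : Γ ⊆ Δ) :
    ContextMap Term.var Γ Δ := by
  intro A hA
  rw [Formula.subst_var]
  exact h hA

theorem ContextMap.shift (s : L.Sorts) (Γ : List (Formula L)) :
    ContextMap (shiftSubst s) Γ (Γ.map (Formula.shift s)) :=
  fun A hA => List.mem_map.2 ⟨A, hA, rfl⟩

/-- Substitution, weakening and conversion of cut-free proofs, keeping neutral proofs neutral. -/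
theorem Proof.IsCutFree.transport {Γ : List (Formula L)} {A : Formula L} (p : Proof R Γ A)
    (hp : p.IsCutFree) {ρ : Subst L} {Δ : List (Formula L)} {B : Formula L}
    (hΔ : ContextMap ρ Γ Δ) (hB : Congr R (A.subst ρ) B) :
    CutFreeProvable R Δ B ∧ (p.IsNeutral → NeutralProvable R Δ B) := by
  -- Each rule now has one goal: the left alternative for introductions, the right one for axioms
  -- and eliminations.
  suffices h : (¬ p.IsNeutral ∧ CutFreeProvable R Δ B) ∨ NeutralProvable R Δ B by
    rcases h with h | h
    · exact ⟨h.2, fun h' => absurd h' h.1⟩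
    · exact ⟨h.cutFree, fun _ => h⟩
  induction p generalizing ρ Δ B with
  | hyp A C hA h => exact .inr (.hyp (hΔ _ hA) (hB.symm.trans (h.subst ρ)))
  | impI h p ih =>
    -- Neutrality of an introduction computes to `False`, so `id` refutes it. The last rule absorbs
    -- the conversion to `B`; its premise is only substituted.
    refine .inl ⟨id, .impI (hB.symm.trans (h.subst ρ)) ?_⟩
    exact (ih hp (hΔ.cons _) (.refl _)).elim And.right NeutralProvable.cutFree
  | impE h m p ihm ihp =>
    -- The major premise is neutral, which excludes the left alternative, so it stays neutral after
    -- transport and no cut appears.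
    have hm := (ihm hp.1.2 hΔ (.refl _)).resolve_left fun h => h.1 hp.1.1
    exact .inr (.impE ((h.subst ρ).trans (Congr.imp_right hB)) hm
      ((ihp hp.2 hΔ (.refl _)).elim And.right NeutralProvable.cutFree))
  | andI h p q ihp ihq =>
    exact .inl ⟨id, .andI (hB.symm.trans (h.subst ρ))
      ((ihp hp.1 hΔ (.refl _)).elim And.right NeutralProvable.cutFree)
      ((ihq hp.2 hΔ (.refl _)).elim And.right NeutralProvable.cutFree)⟩
  | andE₁ h m ihm =>
    have hm := (ihm hp.2 hΔ (.refl _)).resolve_left fun h => h.1 hp.1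
    exact .inr (.andE₁ ((h.subst ρ).trans (Congr.and_left hB)) hm)
  | andE₂ h m ihm =>
    have hm := (ihm hp.2 hΔ (.refl _)).resolve_left fun h => h.1 hp.1
    exact .inr (.andE₂ ((h.subst ρ).trans (Congr.and_right hB)) hm)
  | orI₁ h p ih =>
    exact .inl ⟨id, .orI₁ (hB.symm.trans (h.subst ρ))
      ((ih hp hΔ (.refl _)).elim And.right NeutralProvable.cutFree)⟩
  | orI₂ h p ih =>
    exact .inl ⟨id, .orI₂ (hB.symm.trans (h.subst ρ))
      ((ih hp hΔ (.refl _)).elim And.right NeutralProvable.cutFree)⟩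
  | orE h p q m ihp ihq ihm =>
    have hm := (ihm hp.1.2 hΔ (.refl _)).resolve_left fun h => h.1 hp.1.1
    -- The minor premises prove the conclusion itself, so the conversion `hB` is passed on to them.
    exact .inr (.orE (h.subst ρ)
      ((ihp hp.2.1 (hΔ.cons _) hB).elim And.right NeutralProvable.cutFree)
      ((ihq hp.2.2 (hΔ.cons _) hB).elim And.right NeutralProvable.cutFree) hm)
  | topI h => exact .inl ⟨id, .topI (hB.symm.trans (h.subst ρ))⟩
  | botE h m ihm =>
    have hm := (ihm hp.2 hΔ (.refl _)).resolve_left fun h => h.1 hp.1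
    exact .inr (.botE (h.subst ρ) hm)
  | allI h p ih =>
    exact .inl ⟨id, .allI (hB.symm.trans (h.subst ρ))
      ((ih hp (hΔ.lift _) (.refl _)).elim And.right NeutralProvable.cutFree)⟩
  | allE t h hC m ihm =>
    have hm := (ihm hp.2 hΔ (.refl _)).resolve_left fun h => h.1 hp.1
    refine .inr (.allE (t.subst ρ) (h.subst ρ) (hB.symm.trans ?_) hm)
    rw [Formula.subst_lift_inst, ← Formula.inst_subst]
    exact hC.subst ρ
  | exI t h hC p ih =>
    refine .inl ⟨id, .exI (t.subst ρ) (hB.symm.trans (h.subst ρ)) ?_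
      ((ih hp hΔ (.refl _)).elim And.right NeutralProvable.cutFree)⟩
    rw [Formula.subst_lift_inst, ← Formula.inst_subst]
    exact hC.subst ρ
  | exE h m p ihm ihp =>
    have hm := (ihm hp.1.2 hΔ (.refl _)).resolve_left fun h => h.1 hp.1.1
    refine .inr (.exE (h.subst ρ) hm
      ((ihp hp.2 ((hΔ.lift _).cons _) ?_).elim And.right NeutralProvable.cutFree))
    rw [Formula.subst_shift]
    exact hB.shift _

theorem CutFreeProvable.transport {Γ Δ : List (Formula L)} {A B : Formula L} {ρ : Subst L}
    (h : CutFreeProvable R Γ A) (hΔ : ContextMap ρ Γ Δ) (hB : Congr R (A.subst ρ) B) :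
    CutFreeProvable R Δ B := by
  obtain ⟨p, hp⟩ := h
  exact (Proof.IsCutFree.transport p hp hΔ hB).1

theorem NeutralProvable.transport {Γ Δ : List (Formula L)} {A B : Formula L} {ρ : Subst L}
    (h : NeutralProvable R Γ A) (hΔ : ContextMap ρ Γ Δ) (hB : Congr R (A.subst ρ) B) :
    NeutralProvable R Δ B := by
  obtain ⟨p, hn, hp⟩ := h
  exact (Proof.IsCutFree.transport p hp hΔ hB).2 hn

end CutFree

/-! ## The algebra of sequents -/

section SequentAlgebra

variable {R : RewriteSystem L}

/-- Sets of sequents that contain the sequents with a neutral cut-free proof, consist of sequents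
with a cut-free proof, and are closed under substitution, weakening and conversion. -/
@[ext]
structure SequentValue (R : RewriteSystem L) : Type u where
  mem : List (Formula L) → Formula L → Prop
  of_neutral : ∀ {Γ A}, NeutralProvable R Γ A → mem Γ A
  cutFree : ∀ {Γ A}, mem Γ A → CutFreeProvable R Γ A
  transport : ∀ {Γ Δ A B} {ρ : Subst L}, mem Γ A → ContextMap ρ Γ Δ →
    Congr R (A.subst ρ) B → mem Δ B

theorem SequentValue.congr (a : SequentValue R) {Γ : List (Formula L)} {A B : Formula L}
    (h : a.mem Γ A) (hAB : Congr R A B) : a.mem Γ B :=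
  a.transport h (.of_subset (List.Subset.refl Γ)) (by rwa [Formula.subst_var])

theorem SequentValue.subst (a : SequentValue R) {Γ Δ : List (Formula L)} {A : Formula L}
    {ρ : Subst L} (h : a.mem Γ A) (hΔ : ContextMap ρ Γ Δ) : a.mem Δ (A.subst ρ) :=
  a.transport h hΔ (.refl _)

theorem SequentValue.weaken (a : SequentValue R) {Γ Δ : List (Formula L)} {A : Formula L}
    (h : a.mem Γ A) (hΔ : Γ ⊆ Δ) : a.mem Δ A :=
  a.transport h (.of_subset hΔ) (by rw [Formula.subst_var]; exact .refl _)

/-- The sequents with a neutral cut-free proof, and those with a cut-free proof that satisfy `K`. -/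
def SequentValue.of (K : List (Formula L) → Formula L → Prop)
    (hK : ∀ {Γ Δ A B} {ρ : Subst L}, K Γ A → ContextMap ρ Γ Δ → Congr R (A.subst ρ) B → K Δ B) :
    SequentValue R where
  -- Neutral sequents are added outright because they need not satisfy `K`: a hypothesis can be any
  -- proposition.
  mem Γ A := NeutralProvable R Γ A ∨ CutFreeProvable R Γ A ∧ K Γ A
  of_neutral h := .inl h
  cutFree h := h.elim NeutralProvable.cutFree And.left
  transport h hΔ hB :=
    h.imp (fun h => h.transport hΔ hB) fun h => ⟨h.1.transport hΔ hB, hK h.2 hΔ hB⟩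

/-- The sequents with a cut-free proof. -/
def SequentValue.top (R : RewriteSystem L) : SequentValue R where
  mem := CutFreeProvable R
  of_neutral h := h.cutFree
  cutFree h := h
  transport := CutFreeProvable.transport

/-- The sequents with a neutral cut-free proof. -/
def SequentValue.bot (R : RewriteSystem L) : SequentValue R where
  mem := NeutralProvable R
  of_neutral h := h
  cutFree h := h.cutFree
  transport := NeutralProvable.transport

/-- Implication of sets of sequents. -/
def SequentValue.imp (a b : SequentValue R) : SequentValue R :=
  -- Quantifying over all `ρ` and `Δ` makes the clause stable under transport, by composing
  -- substitutions.
  .of (fun Γ C => ∃ A B, Congr R C (.imp A B) ∧ ∀ ρ Δ, ContextMap ρ Γ Δ →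
      a.mem Δ (A.subst ρ) → b.mem Δ (B.subst ρ)) (by
    rintro Γ Δ C C' ρ ⟨A, B, h, hAB⟩ hΔ hC
    refine ⟨A.subst ρ, B.subst ρ, hC.symm.trans (h.subst ρ), fun τ Θ hΘ => ?_⟩
    rw [Formula.subst_subst, Formula.subst_subst]
    exact hAB _ _ (hΔ.comp hΘ))

/-- Conjunction of sets of sequents. -/
def SequentValue.and (a b : SequentValue R) : SequentValue R :=
  .of (fun Γ C => ∃ A B, Congr R C (.and A B) ∧ a.mem Γ A ∧ b.mem Γ B) (by
    rintro Γ Δ C C' ρ ⟨A, B, h, hA, hB⟩ hΔ hC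
    exact ⟨A.subst ρ, B.subst ρ, hC.symm.trans (h.subst ρ), a.subst hA hΔ, b.subst hB hΔ⟩)

/-- Disjunction of sets of sequents. -/
def SequentValue.or (a b : SequentValue R) : SequentValue R :=
  .of (fun Γ C => ∃ A B, Congr R C (.or A B) ∧ (a.mem Γ A ∨ b.mem Γ B)) (by
    rintro Γ Δ C C' ρ ⟨A, B, h, hAB⟩ hΔ hC
    exact ⟨A.subst ρ, B.subst ρ, hC.symm.trans (h.subst ρ),
      hAB.imp (a.subst · hΔ) (b.subst · hΔ)⟩)

/-- Universal quantification over a family of sets of sequents. -/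
def SequentValue.all (S : Set (SequentValue R)) : SequentValue R :=
  -- Every term is paired with every value of `S`: terms and domain elements are not linked. This
  -- matches adequacy, where the substitution and the assignment vary independently.
  .of (fun Γ C => ∃ s A, Congr R C (.all s A) ∧ ∀ a ∈ S, ∀ ρ Δ, ContextMap ρ Γ Δ →
      ∀ t : Term L s, a.mem Δ (A.subst (extend t ρ))) (by
    rintro Γ Δ C C' ρ ⟨s, A, h, hA⟩ hΔ hC
    refine ⟨s, A.subst (ρ.lift s), hC.symm.trans (h.subst ρ), fun a ha τ Θ hΘ t => ?_⟩
    rw [Formula.subst_lift_extend]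
    exact hA a ha _ _ (hΔ.comp hΘ) t)

/-- Existential quantification over a family of sets of sequents. -/
def SequentValue.ex (S : Set (SequentValue R)) : SequentValue R :=
  .of (fun Γ C => ∃ s A, Congr R C (.ex s A) ∧ ∃ a ∈ S, ∃ t : Term L s, a.mem Γ (A.inst t)) (by
    rintro Γ Δ C C' ρ ⟨s, A, h, a, ha, t, hA⟩ hΔ hC
    refine ⟨s, A.subst (ρ.lift s), hC.symm.trans (h.subst ρ), a, ha, t.subst ρ, ?_⟩
    rw [Formula.subst_lift_inst, ← Formula.inst_subst]
    exact a.subst hA hΔ)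

/-- Intersection of a family of sets of sequents. -/
def SequentValue.inf (S : Set (SequentValue R)) : SequentValue R where
  -- The first conjunct matters for empty `S`, whose greatest lower bound must be the largest value.
  mem Γ A := CutFreeProvable R Γ A ∧ ∀ a ∈ S, a.mem Γ A
  of_neutral h := ⟨h.cutFree, fun a _ => a.of_neutral h⟩
  cutFree h := h.1
  transport h hΔ hB := ⟨h.1.transport hΔ hB, fun a ha => a.transport (h.2 a ha) hΔ hB⟩

/-- The algebra of sequents, ordered by inclusion.  All its truth values are positive. -/
def sequentAlgebra (R : RewriteSystem L) : OrderedTruthValuesAlgebra.{u} where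
  carrier := SequentValue R
  -- Making every value positive trivializes the deduction laws; the use of a model lies in its
  -- invariance under the congruence.
  pos := Set.univ
  allDom := Set.univ
  exDom := Set.univ
  top := .top R
  bot := .bot R
  imp := .imp
  and := .and
  or := .or
  all S := .all S.1
  ex S := .ex S.1
  mp _ _ _ _ := trivial
  imp_k _ _ := trivial
  imp_s _ _ _ := trivial
  top_pos := trivial
  bot_imp _ := trivial
  and_intro _ _ := trivial
  and_left _ _ := trivial
  and_right _ _ := trivial
  or_left _ _ := trivial
  or_right _ _ := trivial
  or_elim _ _ _ := trivial
  imp_allDom _ _ _ := trivial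
  exDom_imp _ _ _ := trivial
  all_intro _ _ := trivial
  all_imp _ _ := trivial
  all_elim _ _ _ := trivial
  ex_intro _ _ _ := trivial
  ex_elim _ _ := trivial
  le a b := ∀ Γ A, a.mem Γ A → b.mem Γ A
  le_refl _ _ _ h := h
  le_antisymm a b h h' := by
    ext Γ A
    exact ⟨h Γ A, h' Γ A⟩
  le_trans _ _ _ h h' Γ A hA := h' Γ A (h Γ A hA)
  pos_upward _ _ _ _ := trivial
  top_maximal a h := by
    ext Γ A
    exact ⟨a.cutFree, h Γ A⟩
  bot_minimal a h := by
    ext Γ A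
    exact ⟨h Γ A, a.of_neutral⟩
  and_mono a a' b b' ha hb Γ C := by
    refine Or.imp_right (And.imp_right ?_)
    rintro ⟨A, B, h, hA, hB⟩
    exact ⟨A, B, h, ha _ _ hA, hb _ _ hB⟩
  or_mono a a' b b' ha hb Γ C := by
    refine Or.imp_right (And.imp_right ?_)
    rintro ⟨A, B, h, hAB⟩
    exact ⟨A, B, h, hAB.imp (ha _ _) (hb _ _)⟩
  imp_mono a a' b b' ha hb Γ C := by
    refine Or.imp_right (And.imp_right ?_)
    rintro ⟨A, B, h, hAB⟩
    exact ⟨A, B, h, fun ρ Δ hΔ hA => hb _ _ (hAB ρ Δ hΔ (ha _ _ hA))⟩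
  all_mono S S' hS Γ C := by
    refine Or.imp_right (And.imp_right ?_)
    rintro ⟨s, A, h, hA⟩
    refine ⟨s, A, h, fun a' ha' ρ Δ hΔ t => ?_⟩
    obtain ⟨a, ha, haa'⟩ := hS a' ha'
    exact haa' _ _ (hA a ha ρ Δ hΔ t)
  ex_mono S S' hS Γ C := by
    refine Or.imp_right (And.imp_right ?_)
    rintro ⟨s, A, h, a, ha, t, hA⟩
    obtain ⟨a', ha', haa'⟩ := hS a ha
    exact ⟨s, A, h, a', ha', t, haa' _ _ hA⟩

theorem sequentAlgebra_isFull (R : RewriteSystem L) :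
    (sequentAlgebra R).toTruthValuesAlgebra.IsFull :=
  ⟨rfl, rfl⟩

theorem sequentAlgebra_isComplete (R : RewriteSystem L) : (sequentAlgebra R).IsComplete :=
  fun S => ⟨SequentValue.inf S, fun a ha _ _ h => h.2 a ha,
    fun b hb Γ A h => ⟨SequentValue.cutFree b h, fun a ha => hb a ha Γ A h⟩⟩

end SequentAlgebra

/-! ## Adequacy -/

section Adequacy

variable {T : Theory L}

/-- The denotation of a proposition as a set of sequents. -/
noncomputable def BStructure.sequents
    (M : BStructure.{u, v, u} L (sequentAlgebra T.rules).toTruthValuesAlgebra)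
    (φ : M.Assignment) (A : Formula L) : SequentValue T.rules :=
  M.denote (sequentAlgebra_isFull T.rules) φ A

variable {M : BStructure.{u, v, u} L (sequentAlgebra T.rules).toTruthValuesAlgebra}

/-- In a model in the algebra of sequents, if `Γ ⊢ B` is provable and `Δ ⊢ σA` belongs to the
denotation of `A` for every hypothesis `A`, then `Δ ⊢ σB` belongs to the denotation of `B`. -/
theorem Proof.mem_sequents (hM : M.IsModel (sequentAlgebra_isFull T.rules) T)
    {Γ : List (Formula L)} {B : Formula L} (p : Proof T.rules Γ B) {Δ : List (Formula L)}
    {σ : Subst L} {φ : M.Assignment} (hΓ : ∀ A ∈ Γ, (M.sequents φ A).mem Δ (A.subst σ)) :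
    (M.sequents φ B).mem Δ (B.subst σ) := by
  have hcongr : ∀ {A A' : Formula L}, Congr T.rules A A' → ∀ φ : M.Assignment,
      M.sequents φ A = M.sequents φ A' := fun h φ => hM.congr _ _ h φ
  have hR := T.confluent
  have cons : ∀ {Γ Δ : List (Formula L)} {σ : Subst L} {φ : M.Assignment} {A : Formula L},
      (∀ X ∈ Γ, (M.sequents φ X).mem Δ (X.subst σ)) → (M.sequents φ A).mem Δ (A.subst σ) →
      ∀ X ∈ A :: Γ, (M.sequents φ X).mem Δ (X.subst σ) := by
    intro Γ Δ σ φ A hΓ hA X hX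
    rcases List.mem_cons.1 hX with rfl | hX
    · exact hA
    · exact hΓ X hX
  -- The added hypothesis is provable by the axiom rule, hence neutral, hence in every value.
  have assume : ∀ {Γ Δ : List (Formula L)} {σ : Subst L} {φ : M.Assignment} {A : Formula L},
      (∀ X ∈ Γ, (M.sequents φ X).mem Δ (X.subst σ)) →
      ∀ X ∈ A :: Γ, (M.sequents φ X).mem (A.subst σ :: Δ) (X.subst σ) := fun hΓ =>
    cons (fun X hX => SequentValue.weaken _ (hΓ X hX) (List.subset_cons_self _ _))
      (SequentValue.of_neutral _ (.hyp List.mem_cons_self (.refl _)))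
  -- `t` and `d` may be unrelated, since shifted propositions ignore both.
  have shift : ∀ {Γ Δ Θ : List (Formula L)} {σ ρ : Subst L} {φ : M.Assignment} {s : L.Sorts}
      (t : Term L s) (d : M.Dom s),
      (∀ X ∈ Γ, (M.sequents φ X).mem Δ (X.subst σ)) → ContextMap ρ Δ Θ →
      ∀ X ∈ Γ.map (Formula.shift s),
        (M.sequents (extend d φ) X).mem Θ (X.subst (extend t (σ.comp ρ))) := by
    intro Γ Δ Θ σ ρ φ s t d hΓ hΘ X hX
    obtain ⟨A, hA, rfl⟩ := List.mem_map.1 hX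
    rw [Formula.shift_subst_extend, ← Formula.subst_subst, BStructure.sequents,
      BStructure.denote_shift]
    exact SequentValue.subst (M.sequents φ A) (hΓ A hA) hΘ
  induction p generalizing Δ σ φ with
  | hyp A B hA h =>
    rw [hcongr h]
    exact SequentValue.congr _ (hΓ A hA) (h.subst σ).symm
  | impI h p ih =>
    rw [hcongr h]
    -- The cut-free proof takes the hypothesis as an axiom; the semantic clause, proved next, takes
    -- an arbitrary member of its denotation.
    refine .inr ⟨.impI (h.subst σ) (SequentValue.cutFree _ (ih (assume hΓ))), _, _, h.subst σ, ?_⟩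
    intro ρ Θ hΘ hA
    rw [Formula.subst_subst] at hA ⊢
    refine ih (cons (fun X hX => ?_) hA)
    rw [← Formula.subst_subst]
    exact SequentValue.subst _ (hΓ X hX) hΘ
  | impE h m p ihm ihp =>
    have hm := ihm hΓ
    rw [hcongr h] at hm
    -- A neutral major premise is eliminated as it stands. Otherwise the clause for implication, at
    -- the identity extension, replaces the potential cut; `Congr.imp_inj` matches `A'` and `B'`
    -- with the expected parts.
    rcases hm with hm | ⟨-, A', B', h', hAB⟩
    · exact SequentValue.of_neutral _ (.impE (h.subst σ) hm (SequentValue.cutFree _ (ihp hΓ)))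
    · obtain ⟨hA, hB⟩ := ((h.subst σ).symm.trans h').imp_inj hR
      have := hAB Term.var Δ (.of_subset (List.Subset.refl _))
      rw [Formula.subst_var, Formula.subst_var] at this
      exact SequentValue.congr _ (this (SequentValue.congr _ (ihp hΓ) hA)) hB.symm
  | andI h p q ihp ihq =>
    rw [hcongr h]
    exact .inr ⟨.andI (h.subst σ) (SequentValue.cutFree _ (ihp hΓ))
      (SequentValue.cutFree _ (ihq hΓ)), _, _, h.subst σ, ihp hΓ, ihq hΓ⟩
  | andE₁ h m ihm =>
    have hm := ihm hΓ
    rw [hcongr h] at hm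
    rcases hm with hm | ⟨-, A', B', h', hA', -⟩
    · exact SequentValue.of_neutral _ (.andE₁ (h.subst σ) hm)
    · exact SequentValue.congr _ hA' (((h.subst σ).symm.trans h').and_inj hR).1.symm
  | andE₂ h m ihm =>
    have hm := ihm hΓ
    rw [hcongr h] at hm
    rcases hm with hm | ⟨-, A', B', h', -, hB'⟩
    · exact SequentValue.of_neutral _ (.andE₂ (h.subst σ) hm)
    · exact SequentValue.congr _ hB' (((h.subst σ).symm.trans h').and_inj hR).2.symm
  | orI₁ h p ih =>
    rw [hcongr h]
    exact .inr ⟨.orI₁ (h.subst σ) (SequentValue.cutFree _ (ih hΓ)), _, _, h.subst σ, .inl (ih hΓ)⟩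
  | orI₂ h p ih =>
    rw [hcongr h]
    exact .inr ⟨.orI₂ (h.subst σ) (SequentValue.cutFree _ (ih hΓ)), _, _, h.subst σ, .inr (ih hΓ)⟩
  | orE h p q m ihp ihq ihm =>
    have hm := ihm hΓ
    rw [hcongr h] at hm
    rcases hm with hm | ⟨-, A', B', h', hAB⟩
    · exact SequentValue.of_neutral _ (.orE (h.subst σ)
        (SequentValue.cutFree _ (ihp (assume hΓ))) (SequentValue.cutFree _ (ihq (assume hΓ))) hm)
    · obtain ⟨hA, hB⟩ := ((h.subst σ).symm.trans h').or_inj hR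
      rcases hAB with hA' | hB'
      · exact ihp (cons hΓ (SequentValue.congr _ hA' hA.symm))
      · exact ihq (cons hΓ (SequentValue.congr _ hB' hB.symm))
  | topI h =>
    rw [hcongr h]
    exact CutFreeProvable.topI (h.subst σ)
  | botE h m ihm =>
    have hm := ihm hΓ
    rw [hcongr h] at hm
    -- Membership in the value of `⊥` is by definition neutral provability.
    exact SequentValue.of_neutral _ (.botE (h.subst σ) hm)
  | @allI Γ s A B h p ih =>
    rw [hcongr h]
    -- For the cut-free proof the eigenvariable stands for itself in the substitution, which is then
    -- `σ.lift s` by unfolding, while any domain element serves in the assignment.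
    obtain ⟨d₀⟩ := M.nonempty s
    refine .inr ⟨.allI (h.subst σ) (SequentValue.cutFree _
      (ih (shift (.var s 0) d₀ hΓ (.shift s Δ)))), s, _, h.subst σ, ?_⟩
    rintro _ ⟨d, rfl⟩ ρ Θ hΘ t
    rw [Formula.subst_lift_extend]
    exact ih (shift t d hΓ hΘ)
  | @allE Γ s A B C t h hC m ihm =>
    have hm := ihm hΓ
    rw [hcongr h] at hm
    have hC' := hC.subst σ
    rw [Formula.inst_subst] at hC'
    rcases hm with hm | ⟨-, s', A', h', hA'⟩
    · refine SequentValue.of_neutral _ (.allE (t.subst σ) (h.subst σ) ?_ hm)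
      rwa [Formula.subst_lift_inst]
    · obtain ⟨rfl, hA⟩ := ((h.subst σ).symm.trans h').all_inj hR
      -- Among the values of the family, the one at the denotation of `t` is that of the instance
      -- `A.inst t`.
      have := hA' _ ⟨M.denoteTerm φ t, rfl⟩ Term.var Δ
        (.of_subset (List.Subset.refl _)) (t.subst σ)
      rw [hcongr hC, BStructure.sequents, BStructure.denote_inst]
      refine SequentValue.congr _ this ?_
      have hA := hA.inst (t.subst σ)
      rw [Formula.subst_lift_inst] at hA
      exact hA.symm.trans hC'.symm
  | @exI Γ s A B C t h hC p ih =>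
    have hp := ih hΓ
    rw [hcongr h]
    have hC' := hC.subst σ
    rw [Formula.inst_subst, ← Formula.subst_lift_inst] at hC'
    refine .inr ⟨.exI (t.subst σ) (h.subst σ) hC' (SequentValue.cutFree _ hp), s, _, h.subst σ,
      _, ⟨M.denoteTerm φ t, rfl⟩, t.subst σ, ?_⟩
    rw [hcongr hC, BStructure.sequents, BStructure.denote_inst] at hp
    exact SequentValue.congr _ hp hC'
  | @exE Γ s A B C h m p ihm ihp =>
    have hm := ihm hΓ
    rw [hcongr h] at hm
    rcases hm with hm | ⟨-, s', A', h', _, ⟨d, rfl⟩, t, hA'⟩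
    · obtain ⟨d₀⟩ := M.nonempty s
      have := SequentValue.cutFree _ (ihp (assume (shift (.var s 0) d₀ hΓ (.shift s Δ))))
      refine SequentValue.of_neutral _ (.exE (h.subst σ) hm ?_)
      rw [← Formula.subst_shift]
      exact this
    · obtain ⟨rfl, hA⟩ := ((h.subst σ).symm.trans h').ex_inj hR
      have hA := (hA.inst t).symm
      rw [Formula.subst_lift_inst] at hA
      -- The witnessing term `t` goes into the substitution and the witnessing element `d` into the
      -- assignment; the shifted conclusion depends on neither.
      have hs := shift t d hΓ (.of_subset (List.Subset.refl _))
      rw [Subst.comp_var] at hs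
      have := ihp (cons hs (SequentValue.congr _ hA' hA))
      rwa [Formula.shift_subst_extend, BStructure.sequents, BStructure.denote_shift] at this

end Adequacy

end DeductionModulo

theorem mainTheorem1 {L : DeductionModulo.Language.{u}} (T : DeductionModulo.Theory L)
    (hT : DeductionModulo.Theory.SuperConsistent.{u, v} T)
    (Γ : List (DeductionModulo.Formula L)) (B : DeductionModulo.Formula L)
    (h : Nonempty (DeductionModulo.Proof T.rules Γ B)) :
    ∃ p : DeductionModulo.Proof T.rules Γ B, p.IsCutFree := by
  obtain ⟨M, hM⟩ := hT (DeductionModulo.sequentAlgebra T.rules)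
    (DeductionModulo.sequentAlgebra_isFull T.rules)
    (DeductionModulo.sequentAlgebra_isComplete T.rules)
  obtain ⟨p⟩ := h
  -- Adequacy at the identity substitution; nonempty domains provide some assignment, and which one
  -- is immaterial.
  have hB := DeductionModulo.SequentValue.cutFree _
    (p.mem_sequents hM (Δ := Γ) (σ := DeductionModulo.Term.var)
      (φ := fun s _ => (M.nonempty s).some) fun A hA =>
        DeductionModulo.SequentValue.of_neutral _
          (.hyp hA (by rw [DeductionModulo.Formula.subst_var]; exact .refl _)))
  rwa [DeductionModulo.Formula.subst_var] at hB
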